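/- Throughout, $\log$ is the logarithm to base two and $[n]=\{1,\dots,n\}$. For a simple graph $G=([n],E)$ let $m=|E|$; for $U\subseteq[n]$ let $m(U)$ be the number of edges of $G$ with both endpoints in $U$, and for disjoint $U,V\subseteq[n]$ let $m(U,V)$ be the number of edges $uv\in E$ with $u\in U$ and $v\in V$. A uniformly random partition of a set $S$ into $k$ (possibly empty) parts $S_1,\dots,S_k$ is obtained by coloring every element of $S$ independently with a uniformly random color from $[k]$ and letting $S_i$ be the set of elements of color $i$. There is an absolute constant $\varsigma>1$ such that the following holds. (A) Let $n \ge 1$, let $G=([n],E)$ be a graph with $m\geq 1$ edges, let $1\le k\le\lfloor n/2\rfloor$, and let $U_1,\dots,U_{2k}$ be a uniformly random partition of $[n]$. Then $$\mathbb{P}\Bigl[\,\Bigl|\frac{m}{2k}-\sum_{i=1}^{k}m(U_i,U_{k+i})\Bigr|\ge\varsigma\sqrt{m}\,\log n\Bigr]\le\frac1{n^4} \quad\text{and}\quad \mathbb{P}\Bigl[\,\Bigl|\frac{m}{2k}-\sum_{i=1}^{2k}m(U_i)\Bigr|\ge\varsigma\sqrt{m}\,\log n\Bigr]\le\frac1{n^4}.$$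 (B) Let $n \ge 1$, let $G=([n],E)$ be a graph, let $U,V\subseteq[n]$ be disjoint sets with $m(U,V)\geq 1$, let $2\le k\le\max\{|U|,|V|\}$, and let $U_1,\dots,U_k$ and $V_1,\dots,V_k$ be independent uniformly random partitions of $U$ and $V$, respectively. Then $$\mathbb{P}\Bigl[\,\Bigl|m(U,V)-k\sum_{i=1}^{k}m(U_i,V_i)\Bigr|\ge\varsigma k\sqrt{m(U,V)}\,\log n\Bigr]\le\frac1{n^4}.$$ -/

import Mathlib

open MeasureTheory ProbabilityTheory

noncomputable section

namespace EdgeSparsification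

/-- The set `E(U)` of edges of `G` with both endpoints in `U`. -/
def edgesWithin {α : Type*} (G : SimpleGraph α) (U : Finset α) : Set (Sym2 α) :=
  {e | e ∈ G.edgeSet ∧ ∀ v ∈ e, v ∈ U}

/-- The set `E(U, V)` of edges `uv` of `G` with `u ∈ U` and `v ∈ V`. -/
def edgesBetween {α : Type*} (G : SimpleGraph α) (U V : Finset α) : Set (Sym2 α) :=
  {e | e ∈ G.edgeSet ∧ ∃ u ∈ U, ∃ v ∈ V, e = s(u, v)}

/-- The number `m` of edges of `G`. -/
def numEdges {α : Type*} (G : SimpleGraph α) : ℕ := G.edgeSet.ncard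

/-- `m(U)`: the number of edges of `G` with both endpoints in `U`. -/
def numWithin {α : Type*} (G : SimpleGraph α) (U : Finset α) : ℕ :=
  (edgesWithin G U).ncard

/-- `m(U, V)`: the number of edges of `G` between `U` and `V`. -/
def numBetween {α : Type*} (G : SimpleGraph α) (U V : Finset α) : ℕ :=
  (edgesBetween G U V).ncard

/-- The law of a random colouring of the elements of `S` with `k` colours: every element
independently receives a uniformly distributed colour. -/
def randomColoring {α : Type*} (S : Finset α) (k : ℕ) : Measure (S → Fin k) :=
  Measure.pi fun _ => uniformOn (Set.univ : Set (Fin k))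

/-- The `i`-th part (possibly empty) of the partition of `S` given by a colouring `c`: the elements
of `S` of colour `i`. Under `randomColoring S k`, these parts form a uniformly random partition of
`S` into `k` parts. -/
def part {α : Type*} {S : Finset α} {k : ℕ} (c : S → Fin k) (i : Fin k) : Finset α :=
  (Finset.univ.filter fun v : S => c v = i).map (Function.Embedding.subtype _)

end EdgeSparsification

end

namespace EdgeSparsification

/-! All the counts are instances of one: edges `uv` whose colours satisfy `σ (c u) = c v` for a
permutation `σ` of the `K` colours (the identity, or the exchange of `i` and `k + i`). The deviation
from `m / K` is the sum over edges of the kernel `1 / K - 1[σ a = b]`, which is centred in each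
variable separately.

Orient the edges along a rank and reveal colours in that order. The deviation splits into
increments, one per vertex `v`, summing the kernel over the in-neighbours of `v`. Centring in the
second variable makes this a martingale. Centring in the first lets Hoeffding bound each increment
by `4 √(d log n)`, with `d` the in-degree, outside an event of probability `O(n⁻⁸)` for each pair of
a vertex and a colour. The squared bounds add up to `16 m log n`, since in-degrees sum to `m`, so
Azuma–Hoeffding (`card_abs_sum_ge_le`), applied to truncated increments, gives deviation `O(√m log
n)`. Probabilities are handled as counts of colourings. -/

/-! ### Exponential moments and Azuma–Hoeffding on finite products -/

lemma exp_mul_le_cosh_add {x s t : ℝ} (hs : 0 < s) (hx : |x| ≤ s) :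
    Real.exp (t * x) ≤ Real.cosh (t * s) + x / s * Real.sinh (t * s) := by
  obtain ⟨h1, h2⟩ := abs_le.mp hx
  -- The exponential lies below its chord over `[-ts, ts]`; the weights `(s ± x) / (2s)` represent
  -- `tx`.
  have h := (convexOn_exp).2 (Set.mem_univ (t * s)) (Set.mem_univ (-(t * s)))
    (div_nonneg (by linarith) (by linarith)) (div_nonneg (by linarith) (by linarith))
    (show (s + x) / (2 * s) + (s - x) / (2 * s) = 1 by field_simp; ring)
  simp only [smul_eq_mul] at h
  have e : (s + x) / (2 * s) * (t * s) + (s - x) / (2 * s) * -(t * s) = t * x := by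
    field_simp; ring
  rw [e] at h
  refine h.trans (le_of_eq ?_)
  rw [Real.cosh_eq, Real.sinh_eq]
  field_simp
  ring

/-- Hoeffding's lemma for the uniform distribution on a finite type. -/
lemma sum_exp_le_of_sum_eq_zero {κ : Type*} [Fintype κ] {x : κ → ℝ} {s : ℝ} (t : ℝ)
    (hx : ∀ a, |x a| ≤ s) (h0 : ∑ a, x a = 0) :
    ∑ a, Real.exp (t * x a) ≤ Fintype.card κ * Real.exp (t ^ 2 / 2 * s ^ 2) := by
  rcases isEmpty_or_nonempty κ with hκ | ⟨⟨a₀⟩⟩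
  · simp
  rcases (((abs_nonneg _).trans (hx a₀)).eq_or_lt) with rfl | hs
  · have : ∀ a, x a = 0 := fun a => abs_nonpos_iff.mp (hx a)
    simp [this]
  calc ∑ a, Real.exp (t * x a)
      ≤ ∑ a, (Real.cosh (t * s) + x a / s * Real.sinh (t * s)) :=
        Finset.sum_le_sum fun a _ => exp_mul_le_cosh_add hs (hx a)
    _ = Fintype.card κ * Real.cosh (t * s) := by
        rw [Finset.sum_add_distrib, ← Finset.sum_mul, ← Finset.sum_div, h0]
        simp
    _ ≤ _ := by
        gcongr
        refine (Real.cosh_le_exp_half_sq _).trans (le_of_eq ?_)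
        congr 1; ring

/-- Resampling one coordinate preserves the uniform distribution on a finite product. -/
lemma sum_sum_update {ι κ : Type*} [Fintype ι] [DecidableEq ι] [Fintype κ]
    (F : (ι → κ) → ℝ) (v : ι) :
    ∑ c, ∑ a, F (Function.update c v a) = Fintype.card κ * ∑ c, F c := by
  -- Exchanging the coordinate at `v` with the fresh value `a` permutes the pairs `(c, a)`.
  have hinv : Function.Involutive
      (fun p : (ι → κ) × κ => (Function.update p.1 v p.2, p.1 v)) := by
    rintro ⟨c, a⟩
    simp
  have h := Equiv.sum_comp hinv.toPerm (fun p : (ι → κ) × κ => F p.1)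
  rw [Fintype.sum_prod_type, Fintype.sum_prod_type] at h
  simpa [Finset.mul_sum] using h

/-- The Azuma–Hoeffding bound on the moment generating function, for a martingale with respect to
the coordinates of a uniformly random point of a finite product. -/
lemma sum_exp_sum_le {ι κ : Type*} [Fintype ι] [DecidableEq ι] [Fintype κ] [Nonempty κ]
    (r : ι → ℕ) (D : ι → (ι → κ) → ℝ) (s : ι → ℝ)
    (hzero : ∀ v c, ∑ a, D v (Function.update c v a) = 0)
    (hdep : ∀ v w c a, w ≠ v → r v ≤ r w → D v (Function.update c w a) = D v c)
    (hs : ∀ v c, |D v c| ≤ s v) (t : ℝ) (S : Finset ι) :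
    ∑ c, Real.exp (t * ∑ v ∈ S, D v c)
      ≤ Fintype.card (ι → κ) * Real.exp (t ^ 2 / 2 * ∑ v ∈ S, s v ^ 2) := by
  -- Peel off an element `w` of maximal rank: by `hdep` the other increments ignore its coordinate,
  -- so resampling that coordinate affects `D w` alone.
  induction S using Finset.induction_on_max_value r with
  | empty => simp
  | insert w S hw hmax ih =>
    have hK : (0 : ℝ) < Fintype.card κ := by exact_mod_cast Fintype.card_pos
    refine le_of_mul_le_mul_left ?_ hK
    rw [← sum_sum_update _ w]
    calc ∑ c, ∑ a, Real.exp (t * ∑ v ∈ insert w S, D v (Function.update c w a))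
        = ∑ c : ι → κ, Real.exp (t * ∑ v ∈ S, D v c) *
            ∑ a, Real.exp (t * D w (Function.update c w a)) := by
          refine Finset.sum_congr rfl fun c _ => ?_
          rw [Finset.mul_sum]
          refine Finset.sum_congr rfl fun a _ => ?_
          rw [Finset.sum_insert hw, ← Real.exp_add, mul_add, add_comm]
          congr 3
          refine Finset.sum_congr rfl fun v hv => ?_
          exact hdep v w c a (fun h => hw (h ▸ hv)) (hmax v hv)
      _ ≤ ∑ c : ι → κ, Real.exp (t * ∑ v ∈ S, D v c) *
            (Fintype.card κ * Real.exp (t ^ 2 / 2 * s w ^ 2)) := by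
          gcongr with c
          exact sum_exp_le_of_sum_eq_zero t (fun a => hs w _) (hzero w c)
      _ ≤ (Fintype.card (ι → κ) * Real.exp (t ^ 2 / 2 * ∑ v ∈ S, s v ^ 2)) *
            (Fintype.card κ * Real.exp (t ^ 2 / 2 * s w ^ 2)) := by
          rw [← Finset.sum_mul]
          gcongr
      _ = _ := by
          rw [Finset.sum_insert hw, mul_add, Real.exp_add]
          ring

/-- Chernoff's bound, with the optimal exponent `l = t / S`. -/
lemma card_le_of_sum_exp_le {Ω : Type*} [Fintype Ω] (X : Ω → ℝ) {S t : ℝ} (hS : 0 < S)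
    (ht : 0 ≤ t)
    (h : ∀ l : ℝ, ∑ c, Real.exp (l * X c) ≤ Fintype.card Ω * Real.exp (l ^ 2 / 2 * S)) :
    (({c | t ≤ X c} : Set Ω).ncard : ℝ) ≤ Real.exp (-(t ^ 2 / (2 * S))) * Fintype.card Ω := by
  classical
  have h1 : (({c | t ≤ X c} : Set Ω).ncard : ℝ) * Real.exp (t / S * t)
      ≤ ∑ c, Real.exp (t / S * X c) := by
    rw [Set.ncard_eq_toFinset_card', ← nsmul_eq_mul]
    refine (Finset.card_nsmul_le_sum _ _ _ fun c hc => ?_).trans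
      (Finset.sum_le_sum_of_subset_of_nonneg (Finset.subset_univ _)
        fun _ _ _ => (Real.exp_pos _).le)
    have : t ≤ X c := by simpa using hc
    gcongr
  have h2 := h1.trans (h (t / S))
  rw [← le_div_iff₀ (Real.exp_pos _)] at h2
  refine h2.trans (le_of_eq ?_)
  rw [mul_div_assoc, ← Real.exp_sub, mul_comm]
  congr 2
  field_simp
  ring

/-- The Azuma–Hoeffding inequality for a martingale with respect to the coordinates of a uniformly
random point of a finite product. -/
lemma card_abs_sum_ge_le {ι κ : Type*} [Fintype ι] [DecidableEq ι] [Fintype κ] [Nonempty κ]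
    (r : ι → ℕ) (D : ι → (ι → κ) → ℝ) (s : ι → ℝ)
    (hzero : ∀ v c, ∑ a, D v (Function.update c v a) = 0)
    (hdep : ∀ v w c a, w ≠ v → r v ≤ r w → D v (Function.update c w a) = D v c)
    (hs : ∀ v c, |D v c| ≤ s v) {t : ℝ} (ht : 0 ≤ t) (hS : 0 < ∑ v, s v ^ 2) :
    (({c | t ≤ |∑ v, D v c|} : Set (ι → κ)).ncard : ℝ)
      ≤ 2 * Real.exp (-(t ^ 2 / (2 * ∑ v, s v ^ 2))) * Fintype.card (ι → κ) := by
  have hmgf := fun l => sum_exp_sum_le r D s hzero hdep hs l Finset.univ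
  have h1 := card_le_of_sum_exp_le (fun c => ∑ v, D v c) hS ht hmgf
  have h2 := card_le_of_sum_exp_le (fun c => -∑ v, D v c) hS ht (fun l => by
    simpa using hmgf (-l))
  have hsub : ({c | t ≤ |∑ v, D v c|} : Set (ι → κ)) ⊆
      {c | t ≤ ∑ v, D v c} ∪ {c | t ≤ -∑ v, D v c} := fun c (hc : t ≤ |_|) => le_abs.mp hc
  have h3 : (({c | t ≤ |∑ v, D v c|} : Set (ι → κ)).ncard : ℝ) ≤
      ({c | t ≤ ∑ v, D v c} : Set (ι → κ)).ncard +
        ({c | t ≤ -∑ v, D v c} : Set (ι → κ)).ncard := by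
    exact_mod_cast (Set.ncard_le_ncard hsub).trans (Set.ncard_union_le _ _)
  linarith

/-- Hoeffding's inequality for a sum of a bounded centred function of the colours of the elements
of a set. -/
lemma card_abs_sum_color_ge_le {ι κ : Type*} [Fintype ι] [DecidableEq ι] [Fintype κ] [Nonempty κ]
    (N : Finset ι) (hN : N.Nonempty) (g : κ → ℝ) (h0 : ∑ a, g a = 0) (hg : ∀ a, |g a| ≤ 1)
    {t : ℝ} (ht : 0 ≤ t) :
    (({c | t ≤ |∑ u ∈ N, g (c u)|} : Set (ι → κ)).ncard : ℝ)
      ≤ 2 * Real.exp (-(t ^ 2 / (2 * N.card))) * Fintype.card (ι → κ) := by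
  have hS : ∑ u : ι, (if u ∈ N then (1 : ℝ) else 0) ^ 2 = N.card := by
    simp [ite_pow]
  -- With constant rank, `hdep` asks each increment to depend on its own coordinate only: the
  -- independent case.
  have h := card_abs_sum_ge_le (κ := κ) (fun _ : ι => 0)
    (fun u c => if u ∈ N then g (c u) else 0) (fun u => if u ∈ N then 1 else 0)
    (fun v c => by by_cases h : v ∈ N <;> simp [h, h0])
    (fun v w c a hne _ => by simp [Function.update_of_ne hne.symm])
    (fun v c => by by_cases h : v ∈ N <;> simp [h, hg]) ht
    (by rw [hS]; exact_mod_cast hN.card_pos)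
  rw [hS] at h
  simpa using h

lemma ncard_exists_le_sum {α Ω : Type*} [Fintype α] [Finite Ω] (P : α → Ω → Prop) :
    ({c | ∃ p, P p c} : Set Ω).ncard ≤ ∑ p, ({c | P p c} : Set Ω).ncard := by
  classical
  have := Fintype.ofFinite Ω
  have h : ({c | ∃ p, P p c} : Set Ω).toFinset
      = Finset.univ.biUnion fun p => ({c | P p c} : Set Ω).toFinset := by
    ext c; simp
  simp only [Set.ncard_eq_toFinset_card', h]
  exact Finset.card_biUnion_le

/-! ### Quadratic forms in independent colours -/

/-- The in-neighbours of `v` in a set of oriented edges. -/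
def inNeighbors {ι : Type*} [Fintype ι] [DecidableEq ι] (E : Finset (ι × ι)) (v : ι) : Finset ι :=
  {u | (u, v) ∈ E}

lemma sum_inNeighbors {ι : Type*} [Fintype ι] [DecidableEq ι] (E : Finset (ι × ι))
    (f : ι → ι → ℝ) : ∑ v, ∑ u ∈ inNeighbors E v, f u v = ∑ p ∈ E, f p.1 p.2 := by
  simp only [inNeighbors, Finset.sum_filter]
  rw [Finset.sum_comm, ← Fintype.sum_prod_type' (fun u v => if (u, v) ∈ E then f u v else 0)]
  simp

lemma sum_card_inNeighbors {ι : Type*} [Fintype ι] [DecidableEq ι] (E : Finset (ι × ι)) :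
    ∑ v, ((inNeighbors E v).card : ℝ) = E.card := by
  simpa using sum_inNeighbors E (fun _ _ => 1)

lemma update_inNeighbors {ι κ : Type*} [Fintype ι] [DecidableEq ι] {E : Finset (ι × ι)}
    {r : ι → ℕ} (hr : ∀ p ∈ E, r p.1 < r p.2) {u v w : ι} (hu : u ∈ inNeighbors E v)
    (hvw : r v ≤ r w) (c : ι → κ) (a : κ) : Function.update c w a u = c u := by
  have h : r u < r v := hr (u, v) (by simpa [inNeighbors] using hu)
  exact Function.update_of_ne (by rintro rfl; omega) _ _

/-- Concentration of a quadratic form in independent uniform colours, with a kernel that is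
centred in its second variable: outside of the event that some increment of the associated
martingale is large, the Azuma–Hoeffding inequality applies. -/
lemma card_abs_sum_kernel_ge_le {ι κ : Type*} [Fintype ι] [DecidableEq ι] [Fintype κ] [Nonempty κ]
    (E : Finset (ι × ι)) (r : ι → ℕ) (hr : ∀ p ∈ E, r p.1 < r p.2)
    (h : κ → κ → ℝ) (hr0 : ∀ a, ∑ b, h a b = 0) (T : ι → ℝ) (hT : ∀ v, 0 ≤ T v) {t : ℝ} (ht : 0 ≤ t)
    (hS : 0 < ∑ v, T v ^ 2) :
    (({c | t ≤ |∑ p ∈ E, h (c p.1) (c p.2)|} : Set (ι → κ)).ncard : ℝ)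
      ≤ 2 * Real.exp (-(t ^ 2 / (2 * ∑ v, T v ^ 2))) * Fintype.card (ι → κ)
        + ∑ q : ι × κ,
          (({c | T q.1 < |∑ u ∈ inNeighbors E q.1, h (c u) q.2|} : Set (ι → κ)).ncard : ℝ) := by
  classical
  -- Truncation preserves the martingale property because `Good v` ranges over all colours `b`
  -- instead of using `c v`: it depends only on in-neighbours, which have smaller rank.
  let Good : ι → (ι → κ) → Prop := fun v c => ∀ b, |∑ u ∈ inNeighbors E v, h (c u) b| ≤ T v
  let D : ι → (ι → κ) → ℝ := fun v c =>
    if Good v c then ∑ u ∈ inNeighbors E v, h (c u) (c v) else 0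
  have hupd : ∀ v w c a b, r v ≤ r w →
      ∑ u ∈ inNeighbors E v, h (Function.update c w a u) b
        = ∑ u ∈ inNeighbors E v, h (c u) b := fun v w c a b hvw =>
    Finset.sum_congr rfl fun u hu => by rw [update_inNeighbors hr hu hvw]
  have hgood : ∀ v w c a, r v ≤ r w → (Good v (Function.update c w a) ↔ Good v c) :=
    fun v w c a hvw => by simp only [Good, hupd v w c a _ hvw]
  have haz := card_abs_sum_ge_le r D T
    (fun v c => by
      simp only [D, hgood v v c _ le_rfl, hupd v v c _ _ le_rfl, Function.update_self]
      split_ifs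
      · rw [Finset.sum_comm]
        simp [hr0]
      · simp)
    (fun v w c a hne hvw => by
      simp only [D, hgood v w c _ hvw, hupd v w c _ _ hvw, Function.update_of_ne hne.symm])
    (fun v c => by
      simp only [D]
      split_ifs with hg
      · exact hg _
      · simpa using hT v) ht hS
  have hsub : ({c | t ≤ |∑ p ∈ E, h (c p.1) (c p.2)|} : Set (ι → κ)) ⊆
      {c | t ≤ |∑ v, D v c|} ∪
        {c | ∃ q : ι × κ, T q.1 < |∑ u ∈ inNeighbors E q.1, h (c u) q.2|} := by
    intro c hc
    by_cases hg : ∀ v, Good v c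
    · left
      have : ∑ v, D v c = ∑ p ∈ E, h (c p.1) (c p.2) := by
        simp only [D, hg, if_true]
        exact sum_inNeighbors E (fun u v => h (c u) (c v))
      show t ≤ |∑ v, D v c|
      rw [this]
      exact hc
    · right
      simp only [Good, not_forall, not_le] at hg
      obtain ⟨v, b, hvb⟩ := hg
      exact ⟨(v, b), hvb⟩
  have h1 := (Set.ncard_le_ncard hsub).trans (Set.ncard_union_le _ _)
  have h2 := h1.trans (Nat.add_le_add_left (ncard_exists_le_sum _) _)
  have h3 : (({c | t ≤ |∑ p ∈ E, h (c p.1) (c p.2)|} : Set (ι → κ)).ncard : ℝ) ≤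
      ({c | t ≤ |∑ v, D v c|} : Set (ι → κ)).ncard + ∑ q : ι × κ,
        (({c | T q.1 < |∑ u ∈ inNeighbors E q.1, h (c u) q.2|} : Set (ι → κ)).ncard : ℝ) := by
    exact_mod_cast h2
  linarith

lemma exp_neg_mul_log {n : ℕ} (hn : 2 ≤ n) (k : ℕ) :
    Real.exp (-(k * Real.log n)) = 1 / (n : ℝ) ^ k := by
  rw [Real.exp_neg, ← Real.log_pow, Real.exp_log (by positivity), one_div]

lemma card_abs_sum_kernel_ge_sqrt_mul_log_le {ι κ : Type*} [Fintype ι] [DecidableEq ι] [Fintype κ]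
    [Nonempty κ] (E : Finset (ι × ι)) (hE : E.Nonempty) (r : ι → ℕ)
    (hr : ∀ p ∈ E, r p.1 < r p.2) (h : κ → κ → ℝ) (hl : ∀ b, ∑ a, h a b = 0)
    (hr0 : ∀ a, ∑ b, h a b = 0) (hb : ∀ a b, |h a b| ≤ 1) {n : ℕ} (hn : 2 ≤ n)
    (hι : Fintype.card ι ≤ n) (hκ : Fintype.card κ ≤ n) :
    (({c | 14 * √(E.card : ℝ) * Real.log n ≤ |∑ p ∈ E, h (c p.1) (c p.2)|} :
        Set (ι → κ)).ncard : ℝ) ≤ 1 / (n : ℝ) ^ 4 * Fintype.card (ι → κ) := by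
  have hn' : (2 : ℝ) ≤ n := by exact_mod_cast hn
  have hL : 0 < Real.log n := Real.log_pos (by linarith)
  have hm : (0 : ℝ) < E.card := by exact_mod_cast hE.card_pos
  -- The factor 4 makes the Hoeffding exponent `8 log n`, which leaves `2 / n ^ 6` after a union
  -- bound over at most `n ^ 2` pairs.
  set T : ι → ℝ := fun v => 4 * √((inNeighbors E v).card * Real.log n) with hTdef
  have hTsq : ∀ v, T v ^ 2 = 16 * Real.log n * (inNeighbors E v).card := fun v => by
    rw [hTdef, mul_pow, Real.sq_sqrt (by positivity)]; ring
  have hTsum : ∑ v, T v ^ 2 = 16 * Real.log n * E.card := by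
    simp_rw [hTsq]
    rw [← Finset.mul_sum, sum_card_inNeighbors]
  have hT : ∀ v, 0 ≤ T v := fun v => by positivity
  have hmain := card_abs_sum_kernel_ge_le E r hr h hr0 T hT
    (t := 14 * √(E.card : ℝ) * Real.log n) (by positivity) (by rw [hTsum]; positivity)
  have hexp : Real.exp (-((14 * √(E.card : ℝ) * Real.log n) ^ 2 / (2 * ∑ v, T v ^ 2)))
      ≤ 1 / (n : ℝ) ^ 6 := by
    rw [← exp_neg_mul_log hn, hTsum, mul_pow, mul_pow, Real.sq_sqrt hm.le]
    -- The constant 14 is chosen so that `14 ^ 2 / 32 = 49 / 8` is at least 6.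
    have e : (14 : ℝ) ^ 2 * E.card * Real.log n ^ 2 / (2 * (16 * Real.log n * E.card))
        = 49 / 8 * Real.log n := by
      field_simp; norm_num
    rw [e]
    gcongr
    norm_num
  have hbad : ∀ q : ι × κ,
      (({c | T q.1 < |∑ u ∈ inNeighbors E q.1, h (c u) q.2|} : Set (ι → κ)).ncard : ℝ)
        ≤ 2 * (1 / (n : ℝ) ^ 8) * Fintype.card (ι → κ) := by
    rintro ⟨v, b⟩
    -- Without in-neighbours the sum is zero, so the strict inequality never holds.
    rcases (inNeighbors E v).eq_empty_or_nonempty with h0 | hne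
    · have : ({c | T v < |∑ u ∈ inNeighbors E v, h (c u) b|} : Set (ι → κ)) = ∅ := by
        ext c
        simp [h0, hT v]
      simp only [this, Set.ncard_empty, Nat.cast_zero]
      positivity
    · have hd : (0 : ℝ) < (inNeighbors E v).card := by exact_mod_cast hne.card_pos
      have hH := card_abs_sum_color_ge_le (ι := ι) (inNeighbors E v) hne (fun a => h a b) (hl b)
        (fun a => hb a b) (hT v)
      have e : T v ^ 2 / (2 * (inNeighbors E v).card) = (8 : ℕ) * Real.log n := by
        rw [hTsq]; field_simp; norm_num
      rw [e, exp_neg_mul_log hn] at hH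
      refine le_trans ?_ hH
      norm_cast
      refine Set.ncard_le_ncard fun c hc => ?_
      rw [Set.mem_ofPred_eq] at hc ⊢
      exact hc.le
  have hN : (0 : ℝ) ≤ Fintype.card (ι → κ) := by positivity
  have hbadsum : ∑ q : ι × κ,
      (({c | T q.1 < |∑ u ∈ inNeighbors E q.1, h (c u) q.2|} : Set (ι → κ)).ncard : ℝ)
        ≤ n * n * (2 * (1 / (n : ℝ) ^ 8) * Fintype.card (ι → κ)) := by
    refine (Finset.sum_le_card_nsmul _ _ _ fun q _ => hbad q).trans ?_
    rw [nsmul_eq_mul, Finset.card_univ, Fintype.card_prod, Nat.cast_mul]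
    gcongr
  have hfin : 2 * (1 / (n : ℝ) ^ 6) + n * n * (2 * (1 / (n : ℝ) ^ 8)) ≤ 1 / (n : ℝ) ^ 4 := by
    have : 2 * (1 / (n : ℝ) ^ 6) + n * n * (2 * (1 / (n : ℝ) ^ 8)) = 4 / (n : ℝ) ^ 6 := by
      field_simp; norm_num
    rw [this, div_le_div_iff₀ (by positivity) (by positivity)]
    nlinarith [mul_nonneg (pow_nonneg (show (0 : ℝ) ≤ n by linarith) 4)
      (show (0 : ℝ) ≤ n ^ 2 - 4 by nlinarith)]
  calc _ ≤ _ := hmain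
    _ ≤ 2 * (1 / (n : ℝ) ^ 6) * Fintype.card (ι → κ)
          + n * n * (2 * (1 / (n : ℝ) ^ 8) * Fintype.card (ι → κ)) := by gcongr
    _ = (2 * (1 / (n : ℝ) ^ 6) + n * n * (2 * (1 / (n : ℝ) ^ 8))) * Fintype.card (ι → κ) := by
        ring
    _ ≤ _ := by gcongr

/-- Concentration of the number of oriented edges whose endpoints have colours matched by a
permutation of the colours. -/
lemma card_abs_matched_sub_ge_le {ι : Type*} [Fintype ι] [DecidableEq ι]
    (E : Finset (ι × ι)) (hE : E.Nonempty) (r : ι → ℕ)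
    (hr : ∀ p ∈ E, r p.1 < r p.2) {K n : ℕ} (σ : Equiv.Perm (Fin K)) (hK : 0 < K) (hn : 2 ≤ n)
    (hι : Fintype.card ι ≤ n) (hKn : K ≤ n) :
    (({c | 14 * √(E.card : ℝ) * Real.logb 2 n ≤
        |(E.card : ℝ) / K - (E.filter fun p => σ (c p.1) = c p.2).card|} :
        Set (ι → Fin K)).ncard : ℝ) ≤ 1 / (n : ℝ) ^ 4 * (K : ℝ) ^ Fintype.card ι := by
  have : NeZero K := ⟨hK.ne'⟩
  have hK' : (1 : ℝ) ≤ K := by exact_mod_cast hK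
  have hinv : (0 : ℝ) < 1 / K ∧ (1 : ℝ) / K ≤ 1 :=
    ⟨by positivity, by rw [div_le_one (by linarith)]; exact hK'⟩
  have hKK : (K : ℝ) * (K : ℝ)⁻¹ = 1 := mul_inv_cancel₀ (by linarith)
  have hmain := card_abs_sum_kernel_ge_sqrt_mul_log_le E hE r hr
    (fun a b : Fin K => 1 / (K : ℝ) - if σ a = b then 1 else 0)
    (fun b => by
      simp [Finset.sum_sub_distrib, ← Equiv.eq_symm_apply, hKK])
    (fun a => by simp [Finset.sum_sub_distrib, hKK])
    (fun a b => by
      rw [abs_le]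
      split_ifs <;> constructor <;> linarith [hinv.1, hinv.2]) hn hι (by simpa using hKn)
  rw [Fintype.card_fun, Fintype.card_fin, Nat.cast_pow] at hmain
  refine le_trans ?_ hmain
  have hlog : Real.log n ≤ Real.logb 2 n := by
    rw [Real.logb, le_div_iff₀ (Real.log_pos one_lt_two)]
    have h2 : Real.log 2 ≤ 1 := by linarith [Real.log_two_lt_d9]
    have : 0 ≤ Real.log n := Real.log_natCast_nonneg n
    nlinarith
  have hsub : ({c | 14 * √(E.card : ℝ) * Real.logb 2 n ≤
        |(E.card : ℝ) / K - (E.filter fun p => σ (c p.1) = c p.2).card|} : Set (ι → Fin K)) ⊆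
      {c | 14 * √(E.card : ℝ) * Real.log n ≤
        |∑ p ∈ E, (1 / (K : ℝ) - if σ (c p.1) = c p.2 then 1 else 0)|} := by
    intro c hc
    have e : ∑ p ∈ E, (1 / (K : ℝ) - if σ (c p.1) = c p.2 then 1 else 0)
        = (E.card : ℝ) / K - (E.filter fun p => σ (c p.1) = c p.2).card := by
      rw [Finset.sum_sub_distrib, Finset.sum_const, Finset.sum_boole, nsmul_eq_mul, mul_one_div]
    rw [Set.mem_ofPred_eq] at hc ⊢
    rw [e]
    refine le_trans ?_ hc
    gcongr
  exact_mod_cast Set.ncard_le_ncard hsub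

/-! ### From counting colourings to probabilities -/

lemma randomColoring_real_singleton {α : Type*} (S : Finset α) (k : ℕ) (c : S → Fin k) :
    (randomColoring S k).real {c} = ((k : ℝ) ^ S.card)⁻¹ := by
  rw [measureReal_def, randomColoring, Measure.pi_singleton]
  simp [uniformOn_univ]

instance {α : Type*} (S : Finset α) (k : ℕ) : IsFiniteMeasure (randomColoring S k) := by
  unfold randomColoring; infer_instance

lemma measureReal_eq_ncard_mul {Ω : Type*} [Finite Ω] [MeasurableSpace Ω]
    [MeasurableSingletonClass Ω] (μ : Measure Ω) [IsFiniteMeasure μ] {x : ℝ}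
    (h : ∀ c, μ.real {c} = x) (A : Set Ω) : μ.real A = A.ncard * x := by
  classical
  have := Fintype.ofFinite Ω
  rw [← Set.coe_toFinset A, ← sum_measureReal_singleton, Set.ncard_coe_finset]
  simp [h]

lemma randomColoring_real {α : Type*} (S : Finset α) (k : ℕ) (A : Set (S → Fin k)) :
    (randomColoring S k).real A = A.ncard * ((k : ℝ) ^ S.card)⁻¹ :=
  measureReal_eq_ncard_mul _ (randomColoring_real_singleton S k) A

/-- A pair of independent colourings is a single uniform colouring of the disjoint sum, so the
counting bounds apply to it. -/
lemma randomColoring_prod_real {α : Type*} (S T : Finset α) (k : ℕ)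
    (A : Set ((S → Fin k) × (T → Fin k))) :
    ((randomColoring S k).prod (randomColoring T k)).real A
      = ({c | (c ∘ Sum.inl, c ∘ Sum.inr) ∈ A} : Set (S ⊕ T → Fin k)).ncard
        * ((k : ℝ) ^ (S.card + T.card))⁻¹ := by
  rw [measureReal_eq_ncard_mul _ (x := ((k : ℝ) ^ (S.card + T.card))⁻¹) _ A]
  · have h : Set.ncard (Equiv.sumArrowEquivProdArrow S T (Fin k) ⁻¹' A) = A.ncard := by
      rw [← Equiv.image_symm_eq_preimage]
      exact Set.ncard_image_of_injective _ (Equiv.injective _)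
    rw [← h]
    rfl
  · rintro ⟨a, b⟩
    rw [← Set.singleton_prod_singleton, measureReal_prod_prod, randomColoring_real_singleton,
      randomColoring_real_singleton, pow_add, mul_inv]

lemma mem_part {α : Type*} {S : Finset α} {k : ℕ} (c : S → Fin k) (i : Fin k) (v : S) :
    (v : α) ∈ part c i ↔ c v = i := by
  simp [part]

lemma sum_card_filter_eq {α β : Type*} [Fintype β] (E : Finset α) (P : β → α → Prop)
    (Q : α → Prop) [∀ i, DecidablePred (P i)] [DecidablePred Q]
    (hPQ : ∀ p ∈ E, Q p ↔ ∃ i, P i p) (hinj : ∀ p ∈ E, ∀ i j, P i p → P j p → i = j) :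
    ∑ i, (E.filter (P i)).card = (E.filter Q).card := by
  classical
  rw [← Finset.card_biUnion]
  · congr 1
    ext p
    simp only [Finset.mem_biUnion, Finset.mem_univ, true_and, Finset.mem_filter]
    constructor
    · rintro ⟨i, hp, hi⟩
      exact ⟨hp, (hPQ p hp).2 ⟨i, hi⟩⟩
    · rintro ⟨hp, hq⟩
      obtain ⟨i, hi⟩ := (hPQ p hp).1 hq
      exact ⟨i, hp, hi⟩
  · intro i _ j _ hij
    refine Finset.disjoint_filter.2 fun p hp hi hj => hij (hinj p hp i j hi hj)

/-! ### Edges of the whole graph as increasing pairs -/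

section Orientation

open Classical in
/-- The edges of a graph, oriented from the smaller to the larger endpoint. -/
noncomputable def orientedEdges {n : ℕ} (G : SimpleGraph (Fin n)) :
    Finset (↥(Finset.univ : Finset (Fin n)) × ↥(Finset.univ : Finset (Fin n))) :=
  {p | p.1.1 < p.2.1 ∧ G.Adj p.1 p.2}

open Classical in
lemma ncard_eq_card_orientedEdges {n : ℕ} (G : SimpleGraph (Fin n)) {F : Set (Sym2 (Fin n))}
    (hF : F ⊆ G.edgeSet) :
    F.ncard = ((orientedEdges G).filter fun p => s(p.1.1, p.2.1) ∈ F).card := by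
  rw [← Set.ncard_coe_finset]
  symm
  refine Set.ncard_congr (fun p _ => s(p.1.1, p.2.1)) (fun p hp => ?_) ?_ ?_
  · simp only [Finset.coe_filter] at hp
    exact hp.2
  · rintro ⟨⟨a, _⟩, ⟨b, _⟩⟩ ⟨⟨a', _⟩, ⟨b', _⟩⟩ h h' e
    simp only [orientedEdges, Finset.mem_coe, Finset.mem_filter] at h h'
    rcases Sym2.eq_iff.1 e with ⟨rfl, rfl⟩ | ⟨rfl, rfl⟩
    · rfl
    · exact absurd h.1.2.1 h'.1.2.1.not_gt
  · intro e he
    induction e with | _ a b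
    have hadj : G.Adj a b := hF he
    rcases lt_or_gt_of_ne hadj.ne with hlt | hlt
    · exact ⟨(⟨a, Finset.mem_univ a⟩, ⟨b, Finset.mem_univ b⟩),
        by simp [orientedEdges, hlt, hadj, he], rfl⟩
    · exact ⟨(⟨b, Finset.mem_univ b⟩, ⟨a, Finset.mem_univ a⟩),
        by simp [orientedEdges, hlt, hadj.symm, Sym2.eq_swap, he], Sym2.eq_swap⟩

lemma numEdges_eq_card_orientedEdges {n : ℕ} (G : SimpleGraph (Fin n)) :
    numEdges G = (orientedEdges G).card := by
  classical
  rw [numEdges, ncard_eq_card_orientedEdges G subset_rfl, Finset.filter_true_of_mem]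
  intro p hp
  simp only [orientedEdges, Finset.mem_filter] at hp
  exact hp.2.2

lemma sum_numWithin_part {n k : ℕ} (G : SimpleGraph (Fin n))
    (c : ↥(Finset.univ : Finset (Fin n)) → Fin k) :
    ∑ i, numWithin G (part c i) = ((orientedEdges G).filter fun p => c p.1 = c p.2).card := by
  classical
  simp_rw [numWithin, ncard_eq_card_orientedEdges G (F := edgesWithin G _) fun e he => he.1]
  refine sum_card_filter_eq _ _ _ ?_ ?_
  · intro p hp
    simp only [orientedEdges, Finset.mem_filter] at hp
    simp [edgesWithin, mem_part, hp.2.2, eq_comm]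
  · intro p _ i j hi hj
    simp only [edgesWithin, Set.mem_ofPred_eq, Sym2.mem_iff, forall_eq_or_imp, forall_eq,
      mem_part] at hi hj
    exact hi.2.1.symm.trans hj.2.1

/-- The permutation of `Fin (2 * k)` exchanging `i` and `k + i` for `i < k`. -/
def swapHalves (k : ℕ) : Equiv.Perm (Fin (2 * k)) :=
  Function.Involutive.toPerm
    (fun a => if h : a.1 < k then ⟨k + a, by omega⟩ else ⟨a - k, by omega⟩) (by
      intro a
      ext
      by_cases h : a.1 < k
      · simp [h]
      · have : a.1 - k < k := by omega
        simp only [h, this, dif_pos, dif_neg, not_false_eq_true]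
        omega)

lemma swapHalves_eq_iff {k : ℕ} (a b : Fin (2 * k)) :
    swapHalves k a = b ↔ a.1 + k = b.1 ∨ b.1 + k = a.1 := by
  change (if h : a.1 < k then (⟨k + a, by omega⟩ : Fin (2 * k)) else ⟨a - k, by omega⟩) = b ↔ _
  rw [Fin.ext_iff]
  split_ifs with h <;> simp only <;> omega

lemma mk_mem_edgesBetween {α : Type*} {G : SimpleGraph α} {U V : Finset α} {u v : α} :
    s(u, v) ∈ edgesBetween G U V ↔ G.Adj u v ∧ (u ∈ U ∧ v ∈ V ∨ v ∈ U ∧ u ∈ V) := by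
  simp only [edgesBetween, Set.mem_ofPred_eq, SimpleGraph.mem_edgeSet, Sym2.eq_iff]
  grind

/-- An edge contributes when its end colours differ by exactly `k`, in either order; as `swapHalves`
is an involution, the orientation does not matter. -/
lemma sum_numBetween_part {n k : ℕ} (G : SimpleGraph (Fin n))
    (c : ↥(Finset.univ : Finset (Fin n)) → Fin (2 * k)) (f g : Fin k → Fin (2 * k))
    (hf : ∀ i, (f i : ℕ) = i) (hg : ∀ i, (g i : ℕ) = k + i) :
    ∑ i, numBetween G (part c (f i)) (part c (g i))
      = ((orientedEdges G).filter fun p => swapHalves k (c p.1) = c p.2).card := by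
  classical
  simp_rw [numBetween, ncard_eq_card_orientedEdges G (F := edgesBetween G _ _) fun e he => he.1]
  refine sum_card_filter_eq _ _ _ ?_ ?_
  · intro p hp
    simp only [orientedEdges, Finset.mem_filter] at hp
    rw [swapHalves_eq_iff]
    simp only [mk_mem_edgesBetween, mem_part, hp.2.2, true_and, Fin.ext_iff, hf, hg]
    have h1 := (c p.1).isLt
    have h2 := (c p.2).isLt
    constructor
    · rintro (h | h)
      · exact ⟨⟨(c p.1).1, by omega⟩, by simp only [true_and]; omega⟩
      · exact ⟨⟨(c p.2).1, by omega⟩, by simp only [true_and]; omega⟩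
    · rintro ⟨i, hi⟩
      omega
  · intro p _ i j hi hj
    simp only [mk_mem_edgesBetween, mem_part, Fin.ext_iff, hf, hg] at hi hj ⊢
    omega

end Orientation

/-! ### Edges between two disjoint sets -/

section Bipartite

variable {n : ℕ} (G : SimpleGraph (Fin n)) (U V : Finset (Fin n))

open Classical in
/-- The edges between two sets, oriented from the first set to the second. -/
noncomputable def crossEdges : Finset ((U ⊕ V) × (U ⊕ V)) :=
  ((Finset.univ : Finset (U × V)).filter fun p => G.Adj p.1 p.2).map
    ⟨fun p => (Sum.inl p.1, Sum.inr p.2), fun p q h => by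
      simpa [Prod.ext_iff] using h⟩

lemma mem_crossEdges (p : (U ⊕ V) × (U ⊕ V)) :
    p ∈ crossEdges G U V ↔ ∃ (u : U) (v : V), G.Adj u v ∧ (Sum.inl u, Sum.inr v) = p := by
  simp only [crossEdges, Finset.mem_map, Finset.mem_filter, Finset.mem_univ, true_and, Prod.exists]
  rfl

variable {U V}

open Classical in
lemma numBetween_eq_card_crossEdges (hUV : Disjoint U V) {U' V' : Finset (Fin n)}
    (hU : U' ⊆ U) (hV : V' ⊆ V) :
    numBetween G U' V' = ((crossEdges G U V).filter fun p =>
      Sum.elim Subtype.val Subtype.val p.1 ∈ U' ∧ Sum.elim Subtype.val Subtype.val p.2 ∈ V').card := by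
  rw [← Set.ncard_coe_finset, numBetween]
  symm
  refine Set.ncard_congr
    (fun p _ => s(Sum.elim Subtype.val Subtype.val p.1, Sum.elim Subtype.val Subtype.val p.2))
    ?_ ?_ ?_
  · intro p hp
    obtain ⟨hp, h1, h2⟩ := Finset.mem_filter.1 (Finset.mem_coe.1 hp)
    obtain ⟨u, v, hadj, rfl⟩ := (mem_crossEdges G U V p).1 hp
    exact mk_mem_edgesBetween.2 ⟨hadj, Or.inl ⟨h1, h2⟩⟩
  · intro p q hp hq e
    obtain ⟨u, v, -, rfl⟩ := (mem_crossEdges G U V p).1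
      (Finset.mem_filter.1 (Finset.mem_coe.1 hp)).1
    obtain ⟨u', v', -, rfl⟩ := (mem_crossEdges G U V q).1
      (Finset.mem_filter.1 (Finset.mem_coe.1 hq)).1
    rcases Sym2.eq_iff.1 e with ⟨h1, h2⟩ | ⟨h1, -⟩
    · rw [Subtype.ext h1, Subtype.ext h2]
    · exact absurd h1 (Finset.disjoint_iff_ne.1 hUV _ u.2 _ v'.2)
  · rintro e ⟨he, u, hu, v, hv, rfl⟩
    exact ⟨(Sum.inl ⟨u, hU hu⟩, Sum.inr ⟨v, hV hv⟩), Finset.mem_coe.2 (Finset.mem_filter.2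
      ⟨(mem_crossEdges G U V _).2 ⟨⟨u, hU hu⟩, ⟨v, hV hv⟩, he, rfl⟩, hu, hv⟩), rfl⟩

lemma numBetween_eq_card_crossEdges_self (hUV : Disjoint U V) :
    numBetween G U V = (crossEdges G U V).card := by
  classical
  rw [numBetween_eq_card_crossEdges G hUV subset_rfl subset_rfl, Finset.filter_true_of_mem]
  intro p hp
  obtain ⟨u, v, -, rfl⟩ := (mem_crossEdges G U V p).1 hp
  exact ⟨u.2, v.2⟩

lemma part_subset {α : Type*} {S : Finset α} {k : ℕ} (c : S → Fin k) (i : Fin k) :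
    part c i ⊆ S := by
  intro v hv
  simp only [part, Finset.mem_map] at hv
  obtain ⟨w, -, rfl⟩ := hv
  exact w.2

lemma sum_numBetween_part_part (hUV : Disjoint U V) {k : ℕ} (c : U ⊕ V → Fin k) :
    ∑ i, numBetween G (part (c ∘ Sum.inl) i) (part (c ∘ Sum.inr) i)
      = ((crossEdges G U V).filter fun p => c p.1 = c p.2).card := by
  classical
  simp_rw [numBetween_eq_card_crossEdges G hUV (part_subset (c ∘ Sum.inl) _)
    (part_subset (c ∘ Sum.inr) _)]
  refine sum_card_filter_eq _ _ _ ?_ ?_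
  · intro p hp
    obtain ⟨u, v, -, rfl⟩ := (mem_crossEdges G U V p).1 hp
    simp [mem_part, eq_comm]
  · intro p hp i j hi hj
    obtain ⟨u, v, -, rfl⟩ := (mem_crossEdges G U V p).1 hp
    simp only [Sum.elim_inl, mem_part] at hi hj
    exact hi.1.symm.trans hj.1

end Bipartite

/-! ### Probability bounds and conclusion -/

lemma two_le_of_numEdges_pos {n : ℕ} {G : SimpleGraph (Fin n)} (h : 0 < numEdges G) : 2 ≤ n := by
  obtain ⟨e, he⟩ := Set.nonempty_of_ncard_ne_zero h.ne'
  induction e with | _ a b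
  have : a ≠ b := SimpleGraph.Adj.ne he
  omega

lemma randomColoring_abs_matched_sub_ge_le {n : ℕ} (G : SimpleGraph (Fin n))
    (hG : 0 < numEdges G) {K : ℕ} (hK : 0 < K) (hKn : K ≤ n) (σ : Equiv.Perm (Fin K)) :
    (randomColoring (Finset.univ : Finset (Fin n)) K).real
      {c | 14 * √(numEdges G : ℝ) * Real.logb 2 n ≤ |(numEdges G : ℝ) / K
        - ((orientedEdges G).filter fun p => σ (c p.1) = c p.2).card|} ≤ 1 / (n : ℝ) ^ 4 := by
  have hm := numEdges_eq_card_orientedEdges G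
  have hK' : (0 : ℝ) < K := by exact_mod_cast hK
  rw [randomColoring_real, ← div_eq_mul_inv, div_le_iff₀ (by positivity), hm]
  have h := card_abs_matched_sub_ge_le (orientedEdges G)
    (Finset.card_pos.1 (hm ▸ hG)) (fun v => v.1.1) (fun p hp => by
      simp only [orientedEdges, Finset.mem_filter] at hp
      exact hp.2.1) σ hK (two_le_of_numEdges_pos hG) (by simp) hKn
  rwa [Fintype.card_coe] at h

lemma randomColoring_prod_abs_sub_ge_le {n : ℕ} (G : SimpleGraph (Fin n)) {U V : Finset (Fin n)}
    (hUV : Disjoint U V) (hG : 0 < numBetween G U V) {k : ℕ} (hk : 0 < k) (hkn : k ≤ n) :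
    ((randomColoring U k).prod (randomColoring V k)).real
      {c | 14 * √(numBetween G U V : ℝ) * Real.logb 2 n ≤ |(numBetween G U V : ℝ) / k
        - ∑ i, (numBetween G (part c.1 i) (part c.2 i) : ℝ)|} ≤ 1 / (n : ℝ) ^ 4 := by
  have hm := numBetween_eq_card_crossEdges_self G hUV
  have hk' : (0 : ℝ) < k := by exact_mod_cast hk
  have hn : 2 ≤ n := by
    obtain ⟨e, he, -⟩ := Set.nonempty_of_ncard_ne_zero hG.ne'
    exact two_le_of_numEdges_pos ((Set.ncard_pos).2 ⟨e, he⟩)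
  have hcard : U.card + V.card ≤ n := by
    rw [← Finset.card_union_of_disjoint hUV]
    exact (Finset.card_le_univ _).trans (by simp)
  -- Rank 0 on `U` and 1 on `V` makes every cross edge increasing.
  have h := card_abs_matched_sub_ge_le (crossEdges G U V)
    (Finset.card_pos.1 (hm ▸ hG)) (Sum.elim (fun _ => 0) (fun _ => 1)) (fun p hp => by
      obtain ⟨u, v, -, rfl⟩ := (mem_crossEdges G U V p).1 hp
      simp) (Equiv.refl (Fin k)) hk hn (by simpa using hcard) hkn
  rw [randomColoring_prod_real, ← div_eq_mul_inv, div_le_iff₀ (by positivity), hm]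
  simp only [Set.mem_ofPred_eq, ← Nat.cast_sum, sum_numBetween_part_part G hUV]
  rw [Fintype.card_sum, Fintype.card_coe, Fintype.card_coe] at h
  exact h

end EdgeSparsification

/-- Parts are indexed from `0`: the pairs `(U_i, U_{k+i})`, `1 ≤ i ≤ k`, are the parts with indices
`i` and `k + i` for `0 ≤ i < k`. -/
theorem mainTheorem4 :
    ∃ ς : ℝ, 1 < ς ∧
      (∀ (n : ℕ) (G : SimpleGraph (Fin n)), 0 < EdgeSparsification.numEdges G →
        ∀ k : ℕ, 1 ≤ k → k ≤ n / 2 →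
          (EdgeSparsification.randomColoring (Finset.univ : Finset (Fin n)) (2 * k)).real
              {c | |(EdgeSparsification.numEdges G : ℝ) / (2 * k)
                    - ∑ i : Fin k, (EdgeSparsification.numBetween G
                        (EdgeSparsification.part c ⟨i, by omega⟩)
                        (EdgeSparsification.part c ⟨k + i, by omega⟩) : ℝ)|
                  ≥ ς * √(EdgeSparsification.numEdges G : ℝ) * Real.logb 2 n}
            ≤ 1 / (n : ℝ) ^ 4 ∧
          (EdgeSparsification.randomColoring (Finset.univ : Finset (Fin n)) (2 * k)).real
              {c | |(EdgeSparsification.numEdges G : ℝ) / (2 * k)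
                    - ∑ i : Fin (2 * k), (EdgeSparsification.numWithin G
                        (EdgeSparsification.part c i) : ℝ)|
                  ≥ ς * √(EdgeSparsification.numEdges G : ℝ) * Real.logb 2 n}
            ≤ 1 / (n : ℝ) ^ 4) ∧
      (∀ (n : ℕ) (G : SimpleGraph (Fin n)) (U V : Finset (Fin n)), Disjoint U V →
        0 < EdgeSparsification.numBetween G U V →
        ∀ k : ℕ, 2 ≤ k → k ≤ max U.card V.card →
          ((EdgeSparsification.randomColoring U k).prod
              (EdgeSparsification.randomColoring V k)).real
              {c | |(EdgeSparsification.numBetween G U V : ℝ)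
                    - k * ∑ i : Fin k, (EdgeSparsification.numBetween G
                        (EdgeSparsification.part c.1 i)
                        (EdgeSparsification.part c.2 i) : ℝ)|
                  ≥ ς * k * √(EdgeSparsification.numBetween G U V : ℝ) * Real.logb 2 n}
            ≤ 1 / (n : ℝ) ^ 4) := by
  refine ⟨14, by norm_num, fun n G hG k hk hkn => ⟨?_, ?_⟩, fun n G U V hUV hG k hk hkn => ?_⟩
  · have h := EdgeSparsification.randomColoring_abs_matched_sub_ge_le G hG (K := 2 * k)
      (by omega) (by omega) (EdgeSparsification.swapHalves k)
    simp only [← Nat.cast_sum, EdgeSparsification.sum_numBetween_part G _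
      (fun i : Fin k => ⟨i, by omega⟩) (fun i => ⟨k + i, by omega⟩) (fun _ => rfl) (fun _ => rfl)]
    push_cast at h
    exact h
  · have h := EdgeSparsification.randomColoring_abs_matched_sub_ge_le G hG (K := 2 * k)
      (by omega) (by omega) (Equiv.refl _)
    simp only [← Nat.cast_sum, EdgeSparsification.sum_numWithin_part]
    push_cast at h
    exact h
  · have hkn' : k ≤ n := hkn.trans (max_le ((Finset.card_le_univ U).trans (by simp))
      ((Finset.card_le_univ V).trans (by simp)))
    have h := EdgeSparsification.randomColoring_prod_abs_sub_ge_le G hUV hG (k := k)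
      (by omega) hkn'
    have hk' : (0 : ℝ) < k := by exact_mod_cast (show 0 < k by omega)
    -- The two events coincide after dividing the inequality by `k`.
    convert h using 3
    ext c
    have e : ∀ x y : ℝ, |x - k * y| = k * |x / k - y| := fun x y => by
      rw [← abs_of_pos hk', ← abs_mul, abs_of_pos hk', mul_sub, mul_div_cancel₀ _ hk'.ne']
    have e' : ∀ x y : ℝ, 14 * k * x * y = k * (14 * x * y) := fun x y => by ring
    rw [e, e', ge_iff_le, mul_le_mul_iff_of_pos_left hk']
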